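/- **Theorem (Multisymplectic form formula).** *Setting.* Let $V$ be an $n$-dimensional abstract cellular complex, with vertices $V_0$ and faces $V_n$ (cells of dimension $0$ and $n$) and an incidence relation that relates cells only to cells of the next dimension; write $v\prec\alpha$ if the vertex $v$ is adherent to the face $\alpha$, i.e. $v=\alpha$ or $v$ is joined to $\alpha$ by a chain of cells each incident to the following, and assume that each face has finitely many adherent vertices. Put $S_v=\{\alpha\in V_n: v\prec\alpha\}$. Let $\mathcal V\subset V_n$ be a finite set of faces and $\mathcal V_0$ the set of vertices adherent to a face of $\mathcal V$. A vertex $v$ is interior to $\mathcal V$ ($v\in\operatorname{int}\mathcal V$) if $S_v\subset\mathcal V$, and frontier ($v\in\operatorname{fr}\mathcal V$) if neither $S_v\subset\mathcal V$ nor $S_v\subset V_n\setminus\mathcal V$. Let $(Y_v)_{v\in V_0}$ be smooth manifolds of dimension $m$, and let $(J^1Y)_\alpha=\prod_{v\prec\alpha}Y_v$, $\Gamma(\mathcal V_0,Y)=\prod_{v\in\mathcal V_0}Y_v$, $(j^1y)(\alpha)=(y(v))_{v\prec\alpha}$ and $(j^1\delta y)(\alpha)=(\delta y(v))_{v\prec\alpha}$.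 Let $\mathcal L_\alpha:(J^1Y)_\alpha\to\mathbb R$ $(\alpha\in V_n)$ be smooth functions, let $G$ be a Lie group with identity $e$, Lie algebra $\mathfrak g$ and Maurer–Cartan form $\theta_g=(dL_{g^{-1}})_g:T_gG\to\mathfrak g$, and let $\Phi_\alpha:(J^1Y)_\alpha\to G$ $(\alpha\in V_n)$ be smooth maps for which $e$ is a regular value. For $v\prec\alpha$ let $\Theta^v_\alpha(\mathcal L)$ and $\Theta^v_\alpha(\Phi)$ be the 1-forms on $(J^1Y)_\alpha$, with values in $\mathbb R$ and $\mathfrak g$, obtained by composing $d\mathcal L_\alpha$ and $\theta\circ d\Phi_\alpha$ with the projection of the tangent space $\prod_{v'\prec\alpha}T_{y_{v'}}Y_{v'}$ onto its factor $T_{y_v}Y_v$. On the manifold $\mathcal M=\Gamma(\mathcal V_0,Y)\times\mathrm{Map}(\mathcal V,\mathfrak g^*)$, whose points are written $(y,\lambda)$ and on which forms on $(J^1Y)_\alpha\times\mathfrak g^*$ are considered by pull-back along $(y,\lambda)\mapsto((j^1y)(\alpha),\lambda_\alpha)$, consider the 1-forms $$\mathbb A_{\mathcal V}(\mathcal L,\Phi)=\sum_{\alpha\in\mathcal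 V}\big(d\mathcal L_\alpha+\lambda_\alpha\circ(\theta\circ d\Phi_\alpha)\big),\qquad \mathcal E(\mathcal L,\Phi)=\sum_{v\in\mathcal V_0\cap\operatorname{int}\mathcal V}\ \sum_{\alpha\in S_v}\big(\Theta^v_\alpha(\mathcal L)+\lambda_\alpha\circ\Theta^v_\alpha(\Phi)\big),$$ where $\circ$ after $\lambda_\alpha$ is the duality pairing. A section $y$ is admissible if $\Phi_\alpha((j^1y)(\alpha))=e$ for all $\alpha\in\mathcal V$, and $\delta y\in T_y\Gamma(\mathcal V_0,Y)$ is admissible if $(d\Phi_\alpha)_{(j^1y)(\alpha)}(j^1\delta y)(\alpha)=0$ for all $\alpha\in\mathcal V$. The point $(y,\lambda)$ is critical for $\mathbb A_{\mathcal V}(\mathcal L,\Phi)$ if $y$ is admissible and $\mathbb A_{\mathcal V}(\mathcal L,\Phi)_{(y,\lambda)}(\delta y,\delta\lambda)=0$ for all $(\delta y,\delta\lambda)\in T_{(y,\lambda)}\mathcal M$ with $\delta y(v)=0$ at every $v\in\operatorname{fr}\mathcal V$. A Jacobi field along a critical $(y,\lambda)$ is a tangent vector $(\delta y,\delta\lambda)\in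 T_{(y,\lambda)}\mathcal M$ such that $\delta y$ is admissible and $(\delta y,\delta\lambda)$ extends to a smooth vector field $D$ on $\mathcal M$ with $\big(L_D\,\mathcal E(\mathcal L,\Phi)\big)_{(y,\lambda)}=0$. *Claim.* If $(y,\lambda)\in\mathcal M$ is critical for $\mathbb A_{\mathcal V}(\mathcal L,\Phi)$ and $((\delta y)^i,(\delta\lambda)^i)$, $i=1,2$, are two Jacobi fields along $(y,\lambda)$, then $$\sum_{v\in\operatorname{fr}\mathcal V}\ \sum_{\alpha\in\mathcal V,\ v\prec\alpha}\Big(d\big(\Theta^v_\alpha(\mathcal L)+\lambda_\alpha\circ\Theta^v_\alpha(\Phi)\big)\Big)_{(y,\lambda)}\Big(\big((\delta y)^1,(\delta\lambda)^1\big),\big((\delta y)^2,(\delta\lambda)^2\big)\Big)=0.$$ -/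

import Mathlib

open scoped Manifold ContDiff

noncomputable section

/-! ### Exterior derivative and Lie derivative of 1-forms on a manifold -/

section Forms

variable {E : Type*} [NormedAddCommGroup E] [NormedSpace ℝ E]
  {H : Type*} [TopologicalSpace H] (I : ModelWithCorners ℝ E H)
  (M : Type*) [TopologicalSpace M] [ChartedSpace H M]

/-- A (not necessarily smooth) real-valued 1-form on `M`. -/
abbrev OneForm := ∀ x : M, TangentSpace I x →L[ℝ] ℝ

variable {M}

/-- The pull-back of the 1-form `η` to the model vector space by the inverse of the preferred
chart at `x₀`. -/
def OneForm.inChart (η : OneForm I M) (x₀ : M) (z : E) : E →L[ℝ] ℝ :=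
  (η ((extChartAt I x₀).symm z)).comp
    (mfderivWithin 𝓘(ℝ, E) I (extChartAt I x₀).symm (Set.range I) z)

/-- The exterior derivative `(dη)_{x₀}(u, w)` of a 1-form, computed in the preferred chart at
`x₀`, with the convention `dη(X, Y) = X(η(Y)) - Y(η(X)) - η([X, Y])`. -/
def OneForm.extDeriv (η : OneForm I M) (x₀ : M) (u w : TangentSpace I x₀) : ℝ :=
  extDerivWithin
    (fun z : E => ContinuousAlternatingMap.ofSubsingleton ℝ E ℝ (0 : Fin 1)
      (OneForm.inChart I η x₀ z))
    (Set.range I) (extChartAt I x₀ x₀)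
    ![mfderiv I 𝓘(ℝ, E) (extChartAt I x₀) x₀ u, mfderiv I 𝓘(ℝ, E) (extChartAt I x₀) x₀ w]

/-- The Lie derivative `(L_D η)_{x₀}` of a 1-form along a vector field, computed in the preferred
chart at `x₀`: in coordinates, `L_D η = ∑ᵢ (∑ⱼ Dʲ ∂ⱼηᵢ + ηⱼ ∂ᵢDʲ) dxⁱ`. -/
def OneForm.lieDeriv (D : ∀ x : M, TangentSpace I x) (η : OneForm I M) (x₀ : M) :
    TangentSpace I x₀ →L[ℝ] ℝ :=
  let z₀ : E := extChartAt I x₀ x₀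
  let η' : E → E →L[ℝ] ℝ := OneForm.inChart I η x₀
  let D' : E → E :=
    VectorField.mpullbackWithin 𝓘(ℝ, E) I (extChartAt I x₀).symm D (Set.range I)
  (fderivWithin ℝ η' (Set.range I) z₀ (D' z₀) +
      (η' z₀).comp (fderivWithin ℝ D' (Set.range I) z₀)).comp
    (mfderiv I 𝓘(ℝ, E) (extChartAt I x₀) x₀)

/-- Smoothness of a vector field. -/
def IsSmoothVectorField [IsManifold I 1 M] (D : ∀ x : M, TangentSpace I x) : Prop :=
  ContMDiff I I.tangent ∞ (fun x => (⟨x, D x⟩ : TangentBundle I M))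

end Forms

/-! ### Finite products of manifolds -/

/-- A finite product of `C^k` manifolds is a `C^k` manifold. -/
instance isManifoldPi {ι : Type*} [Fintype ι] {E : ι → Type*} [∀ i, NormedAddCommGroup (E i)]
    [∀ i, NormedSpace ℝ (E i)] {H : ι → Type*} [∀ i, TopologicalSpace (H i)]
    (I : ∀ i, ModelWithCorners ℝ (E i) (H i)) (k : WithTop ℕ∞)
    (M : ι → Type*) [∀ i, TopologicalSpace (M i)] [∀ i, ChartedSpace (H i) (M i)]
    [∀ i, IsManifold (I i) k (M i)] :
    IsManifold (ModelWithCorners.pi I) k (∀ i, M i) := by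
  apply isManifold_of_contDiffOn
  rintro e e' ⟨f, hf, rfl⟩ ⟨f', hf', rfl⟩
  refine contDiffOn_pi.2 fun i => ?_
  have hc := (contDiffGroupoid k (I i)).compatible (hf i (Set.mem_univ _)) (hf' i (Set.mem_univ _))
  have h1 : ContDiffOn ℝ k (I i ∘ (f i).symm.trans (f' i) ∘ (I i).symm)
      ((I i).symm ⁻¹' ((f i).symm.trans (f' i)).source ∩ Set.range (I i)) := hc.1
  have h2 : ContDiff ℝ k (fun z : ∀ j, E j => z i) := contDiff_pi.1 contDiff_id i
  refine h1.comp h2.contDiffOn ?_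
  rintro z ⟨hz, w, rfl⟩
  exact ⟨⟨hz.1 i (Set.mem_univ _), hz.2 i (Set.mem_univ _)⟩, ⟨w i, rfl⟩⟩

/-! ### Cell complexes -/

/-- An abstract cellular complex with cells of dimension at most `n`: each cell has a dimension,
a cell can only be incident to cells of the next dimension, and each `n`-dimensional cell has
finitely many adherent vertices. -/
structure CellComplex (n : ℕ) where
  Cell : Type*
  dim : Cell → ℕ
  dim_le : ∀ c, dim c ≤ n
  Incident : Cell → Cell → Prop
  dim_incident : ∀ a b, Incident a b → dim b = dim a + 1
  finite_vertices : ∀ c, dim c = n →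
    {v | dim v = 0 ∧ Relation.ReflTransGen Incident v c}.Finite

namespace CellComplex

variable {n : ℕ} (K : CellComplex n)

/-- The vertices (cells of dimension `0`). -/
def Vertex := {c : K.Cell // K.dim c = 0}

/-- The faces (cells of dimension `n`). -/
def Face := {c : K.Cell // K.dim c = n}

/-- `v ≺ α`: the vertex `v` is adherent to the face `α`, i.e. they are equal or joined by a
sequence of cells, each one incident to the following. -/
def Adherent (v : K.Vertex) (α : K.Face) : Prop :=
  Relation.ReflTransGen K.Incident v.1 α.1

/-- The spherical neighbourhood `S_v` of a vertex. -/
def sphere (v : K.Vertex) : Set K.Face := {α | K.Adherent v α}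

/-- The interior vertices of a set of faces. -/
def interior (F : Set K.Face) : Set K.Vertex := {v | K.sphere v ⊆ F}

/-- The exterior vertices of a set of faces. -/
def exterior (F : Set K.Face) : Set K.Vertex := {v | K.sphere v ⊆ Fᶜ}

/-- The frontier vertices of a set of faces. -/
def frontier (F : Set K.Face) : Set K.Vertex :=
  {v | v ∉ K.interior F ∧ v ∉ K.exterior F}

/-- The vertices adherent to a face. -/
def faceVerts (α : K.Face) : Set K.Vertex := {v | K.Adherent v α}

/-- The set `F₀` of the vertices adherent to some face of the finite set of faces `F`. -/
def verts (F : Finset K.Face) : Set K.Vertex := {v | ∃ α ∈ F, K.Adherent v α}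

lemma finite_faceVerts (α : K.Face) : (K.faceVerts α).Finite := by
  refine Set.Finite.of_finite_image (f := Subtype.val)
    ((K.finite_vertices α.1 α.2).subset ?_) Subtype.val_injective.injOn
  rintro _ ⟨v, hv, rfl⟩
  exact ⟨v.2, hv⟩

lemma finite_verts (F : Finset K.Face) : (K.verts F).Finite := by
  have h : K.verts F = ⋃ α ∈ F, K.faceVerts α := by
    ext v
    simp [verts, faceVerts]
  rw [h]
  exact F.finite_toSet.biUnion fun α _ => K.finite_faceVerts α

instance fintypeFaceVerts (α : K.Face) : Fintype (K.faceVerts α) := (K.finite_faceVerts α).fintype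

instance fintypeVerts (F : Finset K.Face) : Fintype (K.verts F) := (K.finite_verts F).fintype

/-- A vertex of a face of `F`, as an element of `F₀`. -/
def inclVert {F : Finset K.Face} (α : F) (v : K.faceVerts α.1) : K.verts F :=
  ⟨v.1, α.1, α.2, v.2⟩

end CellComplex

/-! ### The Lie algebra of the group and the Maurer-Cartan form -/

section LieGroup

variable (l : ℕ) (G : Type*) [TopologicalSpace G] [ChartedSpace (EuclideanSpace ℝ (Fin l)) G]
  [Group G]

/-- The Lie algebra `𝔤 = T_e G`. -/
def LieAlg : Type := GroupLieAlgebra (𝓡 l) G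

/- Since `T_e G` is by definition the model vector space, it carries a norm; it is only used to
regard `𝔤` and its dual as manifolds. -/
instance : NormedAddCommGroup (LieAlg l G) :=
  inferInstanceAs (NormedAddCommGroup (EuclideanSpace ℝ (Fin l)))

instance : NormedSpace ℝ (LieAlg l G) :=
  inferInstanceAs (NormedSpace ℝ (EuclideanSpace ℝ (Fin l)))

/-- The dual `𝔤*` of the Lie algebra. -/
abbrev LieCoalg : Type := LieAlg l G →L[ℝ] ℝ

variable {G}

/-- The Maurer-Cartan form `θ_g : T_g G → 𝔤`, the tangent map at `g` of the left translation by
`g⁻¹`. -/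
def maurerCartan (g : G) : TangentSpace (𝓡 l) g →L[ℝ] LieAlg l G :=
  mfderiv (𝓡 l) (𝓡 l) (fun h : G => g⁻¹ * h) g

end LieGroup

/-! ### Discrete Lagrange problems with constraints valued in a Lie group -/

namespace DiscreteLagrange

section

variable {n : ℕ} {K : CellComplex n} (m : ℕ) (Y : K.Vertex → Type*)
  [∀ v, TopologicalSpace (Y v)] [∀ v, ChartedSpace (EuclideanSpace ℝ (Fin m)) (Y v)]

/-- The fiber `(J¹Y)_α` of the 1-jet bundle. -/
abbrev J1 (Y : K.Vertex → Type*) (α : K.Face) := ∀ v : K.faceVerts α, Y v.1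

/-- The model of the manifold `(J¹Y)_α`. -/
abbrev J1Model (α : K.Face) := ModelWithCorners.pi (fun _ : K.faceVerts α => 𝓡 m)

/-- The manifold `Γ(F₀, Y)` of sections. -/
abbrev Sec (Y : K.Vertex → Type*) (F : Finset K.Face) := ∀ v : K.verts F, Y v.1

/-- The model of the manifold `Γ(F₀, Y)`. -/
abbrev SecModel (F : Finset K.Face) := ModelWithCorners.pi (fun _ : K.verts F => 𝓡 m)

/-- A discrete Lagrangian density: a family of smooth functions `ℒ_α : (J¹Y)_α → ℝ`. -/
structure Lagrangian where
  toFun : ∀ α : K.Face, J1 Y α → ℝ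
  smooth : ∀ α, ContMDiff (J1Model m α) 𝓘(ℝ, ℝ) ∞ (toFun α)

variable (l : ℕ) (G : Type*) [TopologicalSpace G] [ChartedSpace (EuclideanSpace ℝ (Fin l)) G]
  [Group G]

/-- A constraint with values in `G`: a family of smooth maps `Φ_α : (J¹Y)_α → G` having the
identity as a regular value. -/
structure Constraint where
  toFun : ∀ α : K.Face, J1 Y α → G
  smooth : ∀ α, ContMDiff (J1Model m α) (𝓡 l) ∞ (toFun α)
  regular : ∀ α (p : J1 Y α), toFun α p = 1 →
    Function.Surjective (mfderiv (J1Model m α) (𝓡 l) (toFun α) p)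

/-- The manifold `Γ(F₀, Y) × Map(F, 𝔤*)` of section-mappings. -/
abbrev SecMap (F : Finset K.Face) := Sec Y F × (F → LieCoalg l G)

/-- The model of the manifold `Γ(F₀, Y) × Map(F, 𝔤*)`. -/
abbrev SecMapModel (F : Finset K.Face) := (SecModel m F).prod 𝓘(ℝ, F → LieCoalg l G)

end

section

variable {n : ℕ} {K : CellComplex n} {m : ℕ} {Y : K.Vertex → Type*}
  [∀ v, TopologicalSpace (Y v)] [∀ v, ChartedSpace (EuclideanSpace ℝ (Fin m)) (Y v)]
  {l : ℕ} {G : Type*} [TopologicalSpace G] [ChartedSpace (EuclideanSpace ℝ (Fin l)) G]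
  [Group G] {F : Finset K.Face}

/-- The 1-jet extension `(j¹y)(α) = (y(v))_{v ≺ α}`. -/
def jet (y : Sec Y F) (α : F) : J1 Y α.1 := fun v => y (K.inclVert α v)

/-- The 1-jet extension `δy ↦ (j¹δy)(α) = (δy(v))_{v ≺ α}` of tangent vectors, as a linear map
`T_y Γ(F₀, Y) → T_{(j¹y)(α)} (J¹Y)_α`. -/
def jetTangent (y : Sec Y F) (α : F) :
    TangentSpace (SecModel m F) y →L[ℝ] TangentSpace (J1Model m α.1) (jet y α) :=
  ContinuousLinearMap.pi fun v : K.faceVerts α.1 =>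
    ContinuousLinearMap.proj (R := ℝ) (φ := fun _ : K.verts F => EuclideanSpace ℝ (Fin m))
      (K.inclVert α v)

open Classical in
/-- The projection of `T_p (J¹Y)_α = ∏_{v' ≺ α} T Y_{v'}` onto the factor of the vertex `v`. -/
def vertexProj (α : K.Face) (v : K.faceVerts α) (p : J1 Y α) :
    TangentSpace (J1Model m α) p →L[ℝ] TangentSpace (J1Model m α) p :=
  (ContinuousLinearMap.single ℝ (fun _ : K.faceVerts α => EuclideanSpace ℝ (Fin m)) v).comp
    (ContinuousLinearMap.proj (R := ℝ) (φ := fun _ : K.faceVerts α => EuclideanSpace ℝ (Fin m)) v)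

/-- The differential `dℒ_α`. -/
def dLagrangian (L : Lagrangian m Y) (α : K.Face) (p : J1 Y α) :
    TangentSpace (J1Model m α) p →L[ℝ] ℝ :=
  mfderiv (J1Model m α) 𝓘(ℝ, ℝ) (L.toFun α) p

/-- The `𝔤`-valued 1-form `θ ∘ dΦ_α`. -/
def thetaDPhi (Φ : Constraint m Y l G) (α : K.Face) (p : J1 Y α) :
    TangentSpace (J1Model m α) p →L[ℝ] LieAlg l G :=
  (maurerCartan l (Φ.toFun α p)).comp (mfderiv (J1Model m α) (𝓡 l) (Φ.toFun α) p)

/-- The Cartan 1-form `Θ^v_α(ℒ)`: the part of `dℒ_α` in the direction of the vertex `v`, that is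
`∑ᵢ (∂ℒ_α/∂yⁱ_v) dyⁱ_v`. -/
def cartanL (L : Lagrangian m Y) (α : K.Face) (v : K.faceVerts α) (p : J1 Y α) :
    TangentSpace (J1Model m α) p →L[ℝ] ℝ :=
  (dLagrangian L α p).comp (vertexProj α v p)

/-- The Cartan 1-form `Θ^v_α(Φ)`, with values in `𝔤`: the part of `θ ∘ dΦ_α` in the direction of
the vertex `v`. -/
def cartanPhi (Φ : Constraint m Y l G) (α : K.Face) (v : K.faceVerts α) (p : J1 Y α) :
    TangentSpace (J1Model m α) p →L[ℝ] LieAlg l G :=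
  (thetaDPhi Φ α p).comp (vertexProj α v p)

/-- The component `δy` of a tangent vector `(δy, δλ)`. -/
def tangentFst (q : SecMap Y l G F) :
    TangentSpace (SecMapModel m l G F) q →L[ℝ] TangentSpace (SecModel m F) q.1 :=
  ContinuousLinearMap.fst ℝ (K.verts F → EuclideanSpace ℝ (Fin m)) (F → LieCoalg l G)

/-- The action 1-form `𝔸_F(ℒ, Φ)` on `Γ(F₀, Y) × Map(F, 𝔤*)`. -/
def actionForm (L : Lagrangian m Y) (Φ : Constraint m Y l G) (F : Finset K.Face) :
    OneForm (SecMapModel m l G F) (SecMap Y l G F) := fun q =>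
  ∑ α : F, (dLagrangian L α.1 (jet q.1 α) + (q.2 α).comp (thetaDPhi Φ α.1 (jet q.1 α))).comp
    ((jetTangent q.1 α).comp (tangentFst q))

/-- The Cartan 1-form `Θ^v_α(ℒ) + λ_α ∘ Θ^v_α(Φ)` of the action 1-form, as a 1-form on
`Γ(F₀, Y) × Map(F, 𝔤*)` through the projection `(y, λ) ↦ ((j¹y)(α), λ_α)`. -/
def cartanForm (L : Lagrangian m Y) (Φ : Constraint m Y l G) (α : F) (v : K.faceVerts α.1) :
    OneForm (SecMapModel m l G F) (SecMap Y l G F) := fun q =>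
  (cartanL L α.1 v (jet q.1 α) + (q.2 α).comp (cartanPhi Φ α.1 v (jet q.1 α))).comp
    ((jetTangent q.1 α).comp (tangentFst q))

open Classical in
/-- The Euler-Lagrange 1-form
`ℰ(ℒ, Φ) = ∑_{v ∈ int F} ∑_{α ∈ S_v} (Θ^v_α(ℒ) + λ_α ∘ Θ^v_α(Φ))` on `Γ(F₀, Y) × Map(F, 𝔤*)`;
here `S_v ⊆ F` because `v` is interior, and `∑_{α ∈ S_v} Θ^v_α(ℒ)` is the Euler-Lagrange 1-form
of `ℒ` at `v`. -/
def eulerLagrangeForm (L : Lagrangian m Y) (Φ : Constraint m Y l G) (F : Finset K.Face) :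
    OneForm (SecMapModel m l G F) (SecMap Y l G F) := fun q =>
  ∑ v : {v : K.verts F // v.1 ∈ K.interior (F : Set K.Face)},
    ∑ α : {α : F // α.1 ∈ K.sphere v.1.1},
      cartanForm L Φ α.1 ⟨v.1.1, α.2⟩ q

/-- Admissible sections: `Φ_α((j¹y)(α)) = e` for all `α ∈ F`. -/
def IsAdmissible (Φ : Constraint m Y l G) (y : Sec Y F) : Prop :=
  ∀ α : F, Φ.toFun α.1 (jet y α) = 1

/-- Admissible infinitesimal variations: `(dΦ_α)((j¹δy)(α)) = 0` for all `α ∈ F`. -/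
def IsAdmissibleVariation (Φ : Constraint m Y l G) (y : Sec Y F)
    (δy : TangentSpace (SecModel m F) y) : Prop :=
  ∀ α : F, mfderiv (J1Model m α.1) (𝓡 l) (Φ.toFun α.1) (jet y α) (jetTangent y α δy) = 0

/-- The value `δy(v)` of an infinitesimal variation at a vertex. -/
def tangentAt (y : Sec Y F) (v : K.verts F) :
    TangentSpace (SecModel m F) y →L[ℝ] TangentSpace (𝓡 m) (y v) :=
  ContinuousLinearMap.proj (R := ℝ) (φ := fun _ : K.verts F => EuclideanSpace ℝ (Fin m)) v

/-- `(y, λ)` is critical for the action 1-form: `y` is admissible and the action 1-form vanishes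
at `(y, λ)` on the tangent vectors `(δy, δλ)` with `δy` zero at the frontier of `F`. -/
def IsCritical (L : Lagrangian m Y) (Φ : Constraint m Y l G) (q : SecMap Y l G F) : Prop :=
  IsAdmissible Φ q.1 ∧
    ∀ X : TangentSpace (SecMapModel m l G F) q,
      (∀ v : K.verts F, v.1 ∈ K.frontier (F : Set K.Face) →
        tangentAt q.1 v (tangentFst q X) = 0) →
      actionForm L Φ F q X = 0

/-- Jacobi fields along `(y, λ)`: tangent vectors `(δy, δλ)` with `δy` admissible that have an
extension to a smooth vector field `D` with `(L_D ℰ(ℒ, Φ))_{(y, λ)} = 0`. -/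
def IsJacobi [∀ v, IsManifold (𝓡 m) ∞ (Y v)] (L : Lagrangian m Y) (Φ : Constraint m Y l G)
    (q : SecMap Y l G F) (X : TangentSpace (SecMapModel m l G F) q) : Prop :=
  IsAdmissibleVariation Φ q.1 (tangentFst q X) ∧
    ∃ D : ∀ x : SecMap Y l G F, TangentSpace (SecMapModel m l G F) x,
      IsSmoothVectorField (SecMapModel m l G F) D ∧ D q = X ∧
        OneForm.lieDeriv (SecMapModel m l G F) D (eulerLagrangeForm L Φ F) q = 0

end

end DiscreteLagrange

end

open Set Filter Topology

/-! ### Charts of finite products of manifolds -/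

section PiManifold

variable {ι : Type*} [Fintype ι] {E : ι → Type*} [∀ i, NormedAddCommGroup (E i)]
  [∀ i, NormedSpace ℝ (E i)] {H : ι → Type*} [∀ i, TopologicalSpace (H i)]
  (I : ∀ i, ModelWithCorners ℝ (E i) (H i))
  {M : ι → Type*} [∀ i, TopologicalSpace (M i)] [∀ i, ChartedSpace (H i) (M i)]

instance boundarylessPi [∀ i, (I i).Boundaryless] : (ModelWithCorners.pi I).Boundaryless where
  range_eq_univ := by
    change range (Pi.map fun i => (I i)) = univ
    rw [Set.range_piMap]
    simp [ModelWithCorners.range_eq_univ]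

theorem mem_extChartAt_pi_target {p : ∀ i, M i} {z : ∀ i, E i}
    (hz : z ∈ (extChartAt (ModelWithCorners.pi I) p).target) (i : ι) :
    z i ∈ (extChartAt (I i) (p i)).target := by
  rw [extChartAt_target] at hz ⊢
  obtain ⟨h1, w, rfl⟩ := hz
  exact ⟨h1 i (mem_univ i), ⟨w i, rfl⟩⟩

theorem hasMFDerivAt_eval (i : ι) (p : ∀ i, M i) :
    HasMFDerivAt (ModelWithCorners.pi I) (I i) (fun x : ∀ i, M i => x i) p
      (ContinuousLinearMap.proj (R := ℝ) (φ := E) i) := by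
  refine ⟨(continuous_apply i).continuousAt, ?_⟩
  have h : HasFDerivWithinAt (fun z : ∀ i, E i => z i)
      (ContinuousLinearMap.proj (R := ℝ) (φ := E) i) (range (ModelWithCorners.pi I))
      (extChartAt (ModelWithCorners.pi I) p p) :=
    (ContinuousLinearMap.proj (R := ℝ) (φ := E) i).hasFDerivWithinAt
  refine h.congr_of_eventuallyEq ?_ ?_
  · filter_upwards [extChartAt_target_mem_nhdsWithin (I := ModelWithCorners.pi I) p] with z hz
    exact (extChartAt (I i) (p i)).right_inv (mem_extChartAt_pi_target I hz i)
  · exact (extChartAt (I i) (p i)).right_inv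
      (mem_extChartAt_pi_target I (mem_extChartAt_target (I := ModelWithCorners.pi I) p) i)

/-- The derivative of the inverse of a chart of a product is computed componentwise. -/
theorem mfderiv_extChartAt_pi_symm_apply [∀ i, (I i).Boundaryless]
    [∀ i, IsManifold (I i) ∞ (M i)]
    {p : ∀ i, M i} {z : ∀ i, E i}
    (hz : z ∈ (extChartAt (ModelWithCorners.pi I) p).target) (w : ∀ i, E i) (i : ι) :
    (mfderiv 𝓘(ℝ, ∀ i, E i) (ModelWithCorners.pi I)
        (extChartAt (ModelWithCorners.pi I) p).symm z w : ∀ i, E i) i =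
      mfderiv 𝓘(ℝ, E i) (I i) (extChartAt (I i) (p i)).symm (z i) (w i) := by
  have h1 : MDifferentiableAt 𝓘(ℝ, ∀ i, E i) (ModelWithCorners.pi I)
      (extChartAt (ModelWithCorners.pi I) p).symm z := by
    have := mdifferentiableWithinAt_extChartAt_symm hz
    rwa [ModelWithCorners.range_eq_univ, mdifferentiableWithinAt_univ] at this
  have h2 : MDifferentiableAt 𝓘(ℝ, E i) (I i) (extChartAt (I i) (p i)).symm (z i) := by
    have := mdifferentiableWithinAt_extChartAt_symm (mem_extChartAt_pi_target I hz i)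
    rwa [ModelWithCorners.range_eq_univ, mdifferentiableWithinAt_univ] at this
  have h3 := (hasMFDerivAt_eval I i ((extChartAt (ModelWithCorners.pi I) p).symm z)).comp z
    h1.hasMFDerivAt
  have h4 := h2.hasMFDerivAt.comp (f := fun z : ∀ i, E i => z i) z
    (ContinuousLinearMap.proj (R := ℝ) (φ := E) i).hasFDerivAt.hasMFDerivAt
  exact congrArg (fun A : (∀ i, E i) →L[ℝ] E i => A w) (hasMFDerivAt_unique h3 h4)

end PiManifold

/-! ### 1-forms in a chart -/

section Forms

variable {E : Type*} [NormedAddCommGroup E] [NormedSpace ℝ E]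
  {H : Type*} [TopologicalSpace H] {I : ModelWithCorners ℝ E H}
  {M : Type*} [TopologicalSpace M] [ChartedSpace H M]

theorem OneForm.inChart_self [IsManifold I 1 M] (η : OneForm I M) (x₀ : M) :
    OneForm.inChart I η x₀ (extChartAt I x₀ x₀) = η x₀ := by
  have h : ∀ x (A : E →L[ℝ] E), x = x₀ → A = ContinuousLinearMap.id ℝ E →
      (show E →L[ℝ] ℝ from η x).comp A = η x₀ := by
    rintro x A rfl rfl
    exact ContinuousLinearMap.comp_id _
  exact h _ _ (extChartAt_to_inv x₀) mfderivWithin_range_extChartAt_symm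

/-- The exterior derivative is the antisymmetrization of the derivative in a chart. -/
theorem OneForm.extDeriv_eq_fderivWithin [IsManifold I 1 M] {η : OneForm I M} {x₀ : M}
    (hη : DifferentiableWithinAt ℝ (OneForm.inChart I η x₀) (range I) (extChartAt I x₀ x₀))
    (u w : E) :
    OneForm.extDeriv I η x₀ u w =
      fderivWithin ℝ (OneForm.inChart I η x₀) (range I) (extChartAt I x₀ x₀) u w -
        fderivWithin ℝ (OneForm.inChart I η x₀) (range I) (extChartAt I x₀ x₀) w u := by
  have hs : UniqueDiffWithinAt ℝ (range I) (extChartAt I x₀ x₀) :=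
    I.uniqueDiffOn _ (mem_range_self _)
  have hd : DifferentiableWithinAt ℝ
      (fun z : E => ContinuousAlternatingMap.ofSubsingleton ℝ E ℝ (0 : Fin 1)
        (OneForm.inChart I η x₀ z)) (range I) (extChartAt I x₀ x₀) :=
    (ContinuousAlternatingMap.ofSubsingletonLIE (𝕜 := ℝ) (E := E) (F := ℝ) (0 : Fin 1)).differentiableAt
      |>.comp_differentiableWithinAt _ hη
  have hc : ∀ a b : E, fderivWithin ℝ (fun z => OneForm.inChart I η x₀ z a) (range I)
      (extChartAt I x₀ x₀) b =
      fderivWithin ℝ (OneForm.inChart I η x₀) (range I) (extChartAt I x₀ x₀) b a := by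
    intro a b
    rw [fderivWithin_clm_apply hs hη (differentiableWithinAt_const a)]
    simp
  have key : ∀ a b : E, extDerivWithin
      (fun z : E => ContinuousAlternatingMap.ofSubsingleton ℝ E ℝ (0 : Fin 1)
        (OneForm.inChart I η x₀ z)) (range I) (extChartAt I x₀ x₀) ![a, b] =
      fderivWithin ℝ (OneForm.inChart I η x₀) (range I) (extChartAt I x₀ x₀) a b -
        fderivWithin ℝ (OneForm.inChart I η x₀) (range I) (extChartAt I x₀ x₀) b a := by
    intro a b
    rw [extDerivWithin_apply hd hs, Fin.sum_univ_two, ← hc, ← hc]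
    simp [Fin.removeNth, sub_eq_add_neg]
  have h : ∀ A : E →L[ℝ] E, A = ContinuousLinearMap.id ℝ E →
      extDerivWithin (fun z : E => ContinuousAlternatingMap.ofSubsingleton ℝ E ℝ (0 : Fin 1)
        (OneForm.inChart I η x₀ z)) (range I) (extChartAt I x₀ x₀) ![A u, A w] =
      fderivWithin ℝ (OneForm.inChart I η x₀) (range I) (extChartAt I x₀ x₀) u w -
        fderivWithin ℝ (OneForm.inChart I η x₀) (range I) (extChartAt I x₀ x₀) w u := by
    rintro A rfl
    exact key u w
  exact h _ mfderiv_extChartAt_self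

/-- At a zero of `η`, the Lie derivative along `D` only depends on the value of `D`. -/
theorem OneForm.fderivWithin_eq_zero_of_lieDeriv_eq_zero [IsManifold I 1 M] {η : OneForm I M}
    {x₀ : M} {D : ∀ x : M, TangentSpace I x} (h0 : η x₀ = 0)
    (hD : OneForm.lieDeriv I D η x₀ = 0) :
    fderivWithin ℝ (OneForm.inChart I η x₀) (range I) (extChartAt I x₀ x₀) (D x₀) = 0 := by
  have hin : OneForm.inChart I η x₀ (extChartAt I x₀ x₀) = 0 := by
    rw [OneForm.inChart_self, h0]; rfl
  have hD' : (VectorField.mpullbackWithin 𝓘(ℝ, E) I (extChartAt I x₀).symm D (range I)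
      (extChartAt I x₀ x₀) : E) = D x₀ := by
    have h : ∀ x (A : E →L[ℝ] E), x = x₀ → A = ContinuousLinearMap.id ℝ E →
        A.inverse (D x) = D x₀ := by
      rintro x A rfl rfl
      rw [ContinuousLinearMap.inverse_id]; rfl
    exact h _ _ (extChartAt_to_inv x₀) mfderivWithin_range_extChartAt_symm
  unfold OneForm.lieDeriv at hD
  simp only [mfderiv_extChartAt_self] at hD
  rw [hin, hD'] at hD
  simpa using! hD

end Forms

/-! ### The Maurer-Cartan form in a chart -/

section MaurerCartan

variable {l : ℕ} {G : Type*} [TopologicalSpace G] [ChartedSpace (EuclideanSpace ℝ (Fin l)) G]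
  [Group G]

variable (l G) in
/-- The left translation `(s, t) ↦ s⁻¹ t` in the chart at the identity. -/
noncomputable def leftDivInChart (p : EuclideanSpace ℝ (Fin l) × EuclideanSpace ℝ (Fin l)) :
    EuclideanSpace ℝ (Fin l) :=
  extChartAt (𝓡 l) (1 : G)
    (((extChartAt (𝓡 l) (1 : G)).symm p.1)⁻¹ * (extChartAt (𝓡 l) (1 : G)).symm p.2)

variable (l G) in
/-- The Maurer-Cartan form in the chart at the identity. -/
noncomputable def maurerCartanInChart (s : EuclideanSpace ℝ (Fin l)) :
    EuclideanSpace ℝ (Fin l) →L[ℝ] LieAlg l G :=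
  (fderiv ℝ (leftDivInChart l G) (s, s)).comp (ContinuousLinearMap.inr ℝ _ _)

variable [LieGroup (𝓡 l) ∞ G]

theorem contDiffAt_leftDivInChart {s : EuclideanSpace ℝ (Fin l)}
    (hs : s ∈ (extChartAt (𝓡 l) (1 : G)).target) :
    ContDiffAt ℝ ∞ (leftDivInChart l G) (s, s) := by
  have hM : IsManifold (𝓡 l) ∞ G := inferInstance
  have h : ContMDiffAt 𝓘(ℝ, EuclideanSpace ℝ (Fin l)) (𝓡 l) ∞
      (extChartAt (𝓡 l) (1 : G)).symm s :=
    (contMDiffOn_extChartAt_symm (n := ∞) (1 : G)).contMDiffAt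
      ((isOpen_extChartAt_target (I := 𝓡 l) (1 : G)).mem_nhds hs)
  have h1 : ContMDiffAt 𝓘(ℝ, EuclideanSpace ℝ (Fin l) × EuclideanSpace ℝ (Fin l)) (𝓡 l) ∞
      (fun p : EuclideanSpace ℝ (Fin l) × EuclideanSpace ℝ (Fin l) =>
        (extChartAt (𝓡 l) (1 : G)).symm p.1) (s, s) :=
    h.comp (f := Prod.fst) (s, s) contDiff_fst.contMDiff.contMDiffAt
  have h2 : ContMDiffAt 𝓘(ℝ, EuclideanSpace ℝ (Fin l) × EuclideanSpace ℝ (Fin l)) (𝓡 l) ∞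
      (fun p : EuclideanSpace ℝ (Fin l) × EuclideanSpace ℝ (Fin l) =>
        (extChartAt (𝓡 l) (1 : G)).symm p.2) (s, s) :=
    h.comp (f := Prod.snd) (s, s) contDiff_snd.contMDiff.contMDiffAt
  have h3 := h1.inv.mul h2
  have h4 : ContMDiffAt (𝓡 l) 𝓘(ℝ, EuclideanSpace ℝ (Fin l)) ∞ (extChartAt (𝓡 l) (1 : G))
      (((extChartAt (𝓡 l) (1 : G)).symm s)⁻¹ * (extChartAt (𝓡 l) (1 : G)).symm s) := by
    rw [inv_mul_cancel]
    exact contMDiffAt_extChartAt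
  exact (h4.comp (s, s) h3).contDiffAt

theorem contDiffAt_maurerCartanInChart {s : EuclideanSpace ℝ (Fin l)}
    (hs : s ∈ (extChartAt (𝓡 l) (1 : G)).target) :
    ContDiffAt ℝ ∞ (maurerCartanInChart l G) s := by
  have h1 : ContDiffAt ℝ ∞ (fderiv ℝ (leftDivInChart l G)) (s, s) :=
    (contDiffAt_leftDivInChart hs).fderiv_right le_rfl
  have h2 : ContDiffAt ℝ ∞ (fun s : EuclideanSpace ℝ (Fin l) =>
      fderiv ℝ (leftDivInChart l G) (s, s)) s :=
    h1.comp (f := fun s => (s, s)) s (contDiff_id.prodMk contDiff_id).contDiffAt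
  exact h2.clm_comp contDiffAt_const

theorem maurerCartan_comp_mfderiv_symm {s : EuclideanSpace ℝ (Fin l)}
    (hs : s ∈ (extChartAt (𝓡 l) (1 : G)).target) :
    (maurerCartan l ((extChartAt (𝓡 l) (1 : G)).symm s)).comp
        (mfderiv 𝓘(ℝ, EuclideanSpace ℝ (Fin l)) (𝓡 l) (extChartAt (𝓡 l) (1 : G)).symm s) =
      maurerCartanInChart l G s := by
  have hM : IsManifold (𝓡 l) ∞ G := inferInstance
  set g := (extChartAt (𝓡 l) (1 : G)).symm s with hg
  have h1 : MDifferentiableAt 𝓘(ℝ, EuclideanSpace ℝ (Fin l)) (𝓡 l)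
      (extChartAt (𝓡 l) (1 : G)).symm s := by
    have := mdifferentiableWithinAt_extChartAt_symm hs
    rwa [ModelWithCorners.range_eq_univ, mdifferentiableWithinAt_univ] at this
  have h2 : MDifferentiableAt (𝓡 l) (𝓡 l) (fun h : G => g⁻¹ * h) g :=
    ((contMDiff_mul_left (I := 𝓡 l) (n := ∞) (a := g⁻¹)).mdifferentiable (by simp)) g
  have h3 := h2.hasMFDerivAt.comp s h1.hasMFDerivAt
  have h4 : HasMFDerivAt (𝓡 l) 𝓘(ℝ, EuclideanSpace ℝ (Fin l)) (extChartAt (𝓡 l) (1 : G))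
      (g⁻¹ * g) (ContinuousLinearMap.id ℝ (EuclideanSpace ℝ (Fin l))) := by
    rw [inv_mul_cancel]
    have := (mdifferentiableAt_extChartAt (I := 𝓡 l) (mem_chart_source _ (1 : G))).hasMFDerivAt
    rwa [mfderiv_extChartAt_self] at this
  have h34 := h4.comp s h3
  let A : EuclideanSpace ℝ (Fin l) →L[ℝ] EuclideanSpace ℝ (Fin l) :=
    (maurerCartan l g).comp
      (mfderiv 𝓘(ℝ, EuclideanSpace ℝ (Fin l)) (𝓡 l) (extChartAt (𝓡 l) (1 : G)).symm s)
  have h5 : HasFDerivAt (fun t => leftDivInChart l G (s, t)) A s :=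
    hasMFDerivAt_iff_hasFDerivAt.1 h34
  have h6 : HasFDerivAt (fun t => leftDivInChart l G (s, t))
      ((fderiv ℝ (leftDivInChart l G) (s, s)).comp (ContinuousLinearMap.inr ℝ _ _)) s :=
    ((contDiffAt_leftDivInChart hs).differentiableAt (by simp)).hasFDerivAt.comp s
      (hasFDerivAt_prodMk_right s s)
  exact h5.unique h6

end MaurerCartan

/-! ### Calculus in the model vector space -/

section Calculus

variable {E V W : Type*} [NormedAddCommGroup E] [NormedSpace ℝ E]
  [NormedAddCommGroup V] [NormedSpace ℝ V] [NormedAddCommGroup W] [NormedSpace ℝ W]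

theorem hasFDerivAt_fderiv_comp {f : W → V} {π : E →L[ℝ] W} {z : E}
    (hf : ContDiffAt ℝ ∞ f (π z)) :
    HasFDerivAt (fun z => fderiv ℝ f (π z)) ((fderiv ℝ (fderiv ℝ f) (π z)).comp π) z :=
  ((hf.fderiv_right (m := ∞) le_rfl).differentiableAt (by simp)).hasFDerivAt.comp z π.hasFDerivAt

theorem ContDiffAt.fderiv_fderiv_swap {f : W → V} {x : W} (hf : ContDiffAt ℝ ∞ f x) (u w : W) :
    fderiv ℝ (fderiv ℝ f) x u w = fderiv ℝ (fderiv ℝ f) x w u :=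
  (hf.isSymmSndFDerivAt
    (by simpa using WithTop.coe_le_coe.2 (le_top : (2 : ℕ∞) ≤ ⊤))).eq u w

theorem differentiableAt_fderiv_add_comp_fderiv {f : W → ℝ} {φ : W → V} {A : E → V →L[ℝ] ℝ}
    {π : E →L[ℝ] W} {z : E} (hf : ContDiffAt ℝ ∞ f (π z)) (hφ : ContDiffAt ℝ ∞ φ (π z))
    (hA : DifferentiableAt ℝ A z) :
    DifferentiableAt ℝ (fun z => fderiv ℝ f (π z) + (A z).comp (fderiv ℝ φ (π z))) z :=
  (hasFDerivAt_fderiv_comp hf).differentiableAt.add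
    (hA.clm_comp (hasFDerivAt_fderiv_comp hφ).differentiableAt)

/-- The exterior derivative of `π^*(df) + A ∘ π^*(dφ)` vanishes on the kernel of `π^*(dφ)`. -/
theorem fderiv_fderiv_add_comp_fderiv_sub_swap_eq_zero {f : W → ℝ} {φ : W → V}
    {A : E → V →L[ℝ] ℝ} {π : E →L[ℝ] W} {z : E} (hf : ContDiffAt ℝ ∞ f (π z))
    (hφ : ContDiffAt ℝ ∞ φ (π z)) (hA : DifferentiableAt ℝ A z) {u w : E}
    (hu : fderiv ℝ φ (π z) (π u) = 0) (hw : fderiv ℝ φ (π z) (π w) = 0) :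
    fderiv ℝ (fun z => fderiv ℝ f (π z) + (A z).comp (fderiv ℝ φ (π z))) z u (π w) -
      fderiv ℝ (fun z => fderiv ℝ f (π z) + (A z).comp (fderiv ℝ φ (π z))) z w (π u) = 0 := by
  have h := (hasFDerivAt_fderiv_comp hf).add
    (hA.hasFDerivAt.clm_comp (hasFDerivAt_fderiv_comp hφ))
  rw [HasFDerivAt.fderiv (f := fun z => fderiv ℝ f (π z) + (A z).comp (fderiv ℝ φ (π z))) h]
  simp [hu, hw, hf.fderiv_fderiv_swap (π u) (π w), hφ.fderiv_fderiv_swap (π u) (π w)]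

theorem hasFDerivAt_clm_comp_const {A : E → W →L[ℝ] ℝ} {A' : E →L[ℝ] W →L[ℝ] ℝ} {z : E}
    (hA : HasFDerivAt A A' z) (B : V →L[ℝ] W) :
    HasFDerivAt (fun z => (A z).comp B) ((ContinuousLinearMap.precomp ℝ B).comp A') z :=
  ContinuousLinearMap.hasFDerivAt (ContinuousLinearMap.precomp ℝ B :
    (W →L[ℝ] ℝ) →L[ℝ] (V →L[ℝ] ℝ)) |>.comp z hA

end Calculus

/-! ### The Cartan forms in a chart -/

namespace DiscreteLagrange

variable {n : ℕ} {K : CellComplex n} {m : ℕ} {Y : K.Vertex → Type*}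
  [∀ v, TopologicalSpace (Y v)] [∀ v, ChartedSpace (EuclideanSpace ℝ (Fin m)) (Y v)]
  {l : ℕ} {G : Type*} [TopologicalSpace G] [ChartedSpace (EuclideanSpace ℝ (Fin l)) G]
  [Group G] {F : Finset K.Face}

/-- The model vector space of `(J¹Y)_α`. -/
abbrev J1Vec (m : ℕ) (α : K.Face) := K.faceVerts α → EuclideanSpace ℝ (Fin m)

/-- The model vector space of `Γ(F₀, Y) × Map(F, 𝔤*)`. -/
abbrev SecMapVec (m l : ℕ) (G : Type*) [TopologicalSpace G]
    [ChartedSpace (EuclideanSpace ℝ (Fin l)) G] [Group G] (F : Finset K.Face) :=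
  (K.verts F → EuclideanSpace ℝ (Fin m)) × (F → LieCoalg l G)

variable (m l G) in
/-- The projection `(y, λ) ↦ (j¹y)(α)` in coordinates. -/
noncomputable def jetVec (α : F) : SecMapVec m l G F →L[ℝ] J1Vec m α.1 :=
  (ContinuousLinearMap.pi fun v : K.faceVerts α.1 =>
    ContinuousLinearMap.proj (R := ℝ) (φ := fun _ : K.verts F => EuclideanSpace ℝ (Fin m))
      (K.inclVert α v)).comp (ContinuousLinearMap.fst ℝ _ _)

open Classical in
variable (m) in
/-- The projection onto the factor of a vertex in coordinates. -/
noncomputable def vertexVec (α : K.Face) (v : K.faceVerts α) : J1Vec m α →L[ℝ] J1Vec m α :=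
  (ContinuousLinearMap.single ℝ (fun _ : K.faceVerts α => EuclideanSpace ℝ (Fin m)) v).comp
    (ContinuousLinearMap.proj (R := ℝ) (φ := fun _ : K.faceVerts α => EuclideanSpace ℝ (Fin m)) v)

theorem sum_vertexVec (α : K.Face) :
    ∑ v, vertexVec m α v = ContinuousLinearMap.id ℝ (J1Vec m α) := by
  classical
  ext w v
  simp [vertexVec, Finset.sum_apply, Pi.single_apply]

/-- `ℒ_α` in the chart at `p`. -/
noncomputable def lagInChart (L : Lagrangian m Y) {α : K.Face} (p : J1 Y α) (x : J1Vec m α) : ℝ :=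
  L.toFun α ((extChartAt (J1Model m α) p).symm x)

/-- `Φ_α` in the charts at `p` and at the identity. -/
noncomputable def phiInChart (Φ : Constraint m Y l G) {α : K.Face} (p : J1 Y α) (x : J1Vec m α) :
    EuclideanSpace ℝ (Fin l) :=
  extChartAt (𝓡 l) (1 : G) (Φ.toFun α ((extChartAt (J1Model m α) p).symm x))

/-- The 1-form `dℒ_α + λ_α ∘ (θ ∘ dΦ_α)` in the chart at `q`, as a form on the model space of
`(J¹Y)_α`. -/
noncomputable def actionInChart (L : Lagrangian m Y) (Φ : Constraint m Y l G)
    (q : SecMap Y l G F) (α : F) (z : SecMapVec m l G F) : J1Vec m α.1 →L[ℝ] ℝ :=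
  fderiv ℝ (lagInChart L (jet q.1 α)) (jetVec m l G α z) +
    ((z.2 α).comp (maurerCartanInChart l G (phiInChart Φ (jet q.1 α) (jetVec m l G α z)))).comp
      (fderiv ℝ (phiInChart Φ (jet q.1 α)) (jetVec m l G α z))

variable [∀ v, IsManifold (𝓡 m) ∞ (Y v)]

theorem vertexProj_comp_mfderiv_symm {α : K.Face} (v : K.faceVerts α) {p : J1 Y α}
    {x : J1Vec m α} (hx : x ∈ (extChartAt (J1Model m α) p).target) :
    (vertexProj α v ((extChartAt (J1Model m α) p).symm x)).comp
        (mfderiv 𝓘(ℝ, J1Vec m α) (J1Model m α) (extChartAt (J1Model m α) p).symm x) =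
      (mfderiv 𝓘(ℝ, J1Vec m α) (J1Model m α) (extChartAt (J1Model m α) p).symm x).comp
        (vertexVec m α v) := by
  classical
  have hc := mfderiv_extChartAt_pi_symm_apply (fun _ : K.faceVerts α => 𝓡 m) hx
  refine ContinuousLinearMap.ext fun w => funext fun v' => ?_
  refine Eq.trans ?_ (hc _ v').symm
  by_cases h : v' = v
  · subst h
    refine (Pi.single_eq_same (M := fun _ : K.faceVerts α => EuclideanSpace ℝ (Fin m))
      v' _).trans ((hc w v').trans ?_)
    congr 1
    exact (Pi.single_eq_same (M := fun _ : K.faceVerts α => EuclideanSpace ℝ (Fin m))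
      v' _).symm
  · refine (Pi.single_eq_of_ne (M := fun _ : K.faceVerts α => EuclideanSpace ℝ (Fin m))
      h _).trans ?_
    have h0 : vertexVec m α v w v' = 0 :=
      Pi.single_eq_of_ne (M := fun _ : K.faceVerts α => EuclideanSpace ℝ (Fin m)) h _
    let A : EuclideanSpace ℝ (Fin m) →L[ℝ] EuclideanSpace ℝ (Fin m) :=
      mfderiv 𝓘(ℝ, EuclideanSpace ℝ (Fin m)) (𝓡 m) (extChartAt (𝓡 m) (p v')).symm (x v')
    exact ((congrArg A h0).trans (map_zero A)).symm

theorem jetTangent_comp_mfderiv_symm {q : SecMap Y l G F} (α : F) {z : SecMapVec m l G F}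
    (hz : z ∈ (extChartAt (SecMapModel m l G F) q).target)
    (hz' : jetVec m l G α z ∈ (extChartAt (J1Model m α.1) (jet q.1 α)).target) :
    ((jetTangent ((extChartAt (SecMapModel m l G F) q).symm z).1 α).comp
        (tangentFst ((extChartAt (SecMapModel m l G F) q).symm z))).comp
        (mfderiv 𝓘(ℝ, SecMapVec m l G F) (SecMapModel m l G F)
          (extChartAt (SecMapModel m l G F) q).symm z) =
      (mfderiv 𝓘(ℝ, J1Vec m α.1) (J1Model m α.1) (extChartAt (J1Model m α.1) (jet q.1 α)).symm
        (jetVec m l G α z)).comp (jetVec m l G α) := by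
  have h1 : MDifferentiableAt 𝓘(ℝ, SecMapVec m l G F) (SecMapModel m l G F)
      (extChartAt (SecMapModel m l G F) q).symm z := by
    have := mdifferentiableWithinAt_extChartAt_symm hz
    rwa [ModelWithCorners.range_eq_univ, mdifferentiableWithinAt_univ] at this
  have hz1 : z.1 ∈ (extChartAt (SecModel m F) q.1).target := by
    rw [extChartAt_prod] at hz
    exact hz.1
  have h2 : MDifferentiableAt 𝓘(ℝ, K.verts F → EuclideanSpace ℝ (Fin m)) (SecModel m F)
      (extChartAt (SecModel m F) q.1).symm z.1 := by
    have := mdifferentiableWithinAt_extChartAt_symm hz1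
    rwa [ModelWithCorners.range_eq_univ, mdifferentiableWithinAt_univ] at this
  have h3 := (hasMFDerivAt_fst (I := SecModel m F) (I' := 𝓘(ℝ, F → LieCoalg l G))
    (x := (extChartAt (SecMapModel m l G F) q).symm z)).comp z h1.hasMFDerivAt
  have h4 := h2.hasMFDerivAt.comp (f := Prod.fst) z
    (ContinuousLinearMap.fst ℝ (K.verts F → EuclideanSpace ℝ (Fin m))
      (F → LieCoalg l G)).hasFDerivAt.hasMFDerivAt
  have h5 := hasMFDerivAt_unique h3 h4
  refine ContinuousLinearMap.ext fun w => funext fun v => ?_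
  refine Eq.trans ?_ (mfderiv_extChartAt_pi_symm_apply (fun _ : K.faceVerts α.1 => 𝓡 m)
    hz' _ v).symm
  refine Eq.trans ?_ (mfderiv_extChartAt_pi_symm_apply (fun _ : K.verts F => 𝓡 m)
    hz1 w.1 (K.inclVert α v))
  exact congrArg (fun A : SecMapVec m l G F →L[ℝ] (K.verts F → EuclideanSpace ℝ (Fin m)) =>
    A w (K.inclVert α v)) h5

theorem mdifferentiableAt_extChartAt_J1_symm {α : K.Face} {p : J1 Y α} {x : J1Vec m α}
    (hx : x ∈ (extChartAt (J1Model m α) p).target) :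
    MDifferentiableAt 𝓘(ℝ, J1Vec m α) (J1Model m α) (extChartAt (J1Model m α) p).symm x := by
  have := mdifferentiableWithinAt_extChartAt_symm hx
  rwa [ModelWithCorners.range_eq_univ, mdifferentiableWithinAt_univ] at this

theorem contMDiffAt_extChartAt_J1_symm {α : K.Face} {p : J1 Y α} {x : J1Vec m α}
    (hx : x ∈ (extChartAt (J1Model m α) p).target) :
    ContMDiffAt 𝓘(ℝ, J1Vec m α) (J1Model m α) ∞ (extChartAt (J1Model m α) p).symm x :=
  (contMDiffOn_extChartAt_symm (n := ∞) p).contMDiffAt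
    ((isOpen_extChartAt_target (I := J1Model m α) p).mem_nhds hx)

theorem contDiffAt_lagInChart (L : Lagrangian m Y) {α : K.Face} {p : J1 Y α} {x : J1Vec m α}
    (hx : x ∈ (extChartAt (J1Model m α) p).target) : ContDiffAt ℝ ∞ (lagInChart L p) x :=
  ((L.smooth α).contMDiffAt.comp x (contMDiffAt_extChartAt_J1_symm hx)).contDiffAt

theorem dLagrangian_comp_mfderiv_symm (L : Lagrangian m Y) {α : K.Face} {p : J1 Y α}
    {x : J1Vec m α} (hx : x ∈ (extChartAt (J1Model m α) p).target) :
    (dLagrangian L α ((extChartAt (J1Model m α) p).symm x)).comp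
        (mfderiv 𝓘(ℝ, J1Vec m α) (J1Model m α) (extChartAt (J1Model m α) p).symm x) =
      fderiv ℝ (lagInChart L p) x := by
  have h1 : MDifferentiableAt (J1Model m α) 𝓘(ℝ, ℝ) (L.toFun α)
      ((extChartAt (J1Model m α) p).symm x) := (L.smooth α).mdifferentiableAt (by simp)
  have h2 := h1.hasMFDerivAt.comp x (mdifferentiableAt_extChartAt_J1_symm hx).hasMFDerivAt
  let A : J1Vec m α →L[ℝ] ℝ := (dLagrangian L α ((extChartAt (J1Model m α) p).symm x)).comp
    (mfderiv 𝓘(ℝ, J1Vec m α) (J1Model m α) (extChartAt (J1Model m α) p).symm x)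
  have h3 : HasFDerivAt (lagInChart L p) A x := hasMFDerivAt_iff_hasFDerivAt.1 h2
  exact h3.fderiv.symm

variable [LieGroup (𝓡 l) ∞ G]

theorem contDiffAt_phiInChart (Φ : Constraint m Y l G) {α : K.Face} {p : J1 Y α} {x : J1Vec m α}
    (hx : x ∈ (extChartAt (J1Model m α) p).target)
    (hΦ : Φ.toFun α ((extChartAt (J1Model m α) p).symm x) ∈ (extChartAt (𝓡 l) (1 : G)).source) :
    ContDiffAt ℝ ∞ (phiInChart Φ p) x := by
  have hM : IsManifold (𝓡 l) ∞ G := inferInstance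
  have h1 := (Φ.smooth α).contMDiffAt.comp x (contMDiffAt_extChartAt_J1_symm hx)
  rw [extChartAt_source] at hΦ
  exact ((contMDiffAt_extChartAt' hΦ).comp x h1).contDiffAt

theorem thetaDPhi_comp_mfderiv_symm (Φ : Constraint m Y l G) {α : K.Face} {p : J1 Y α}
    {x : J1Vec m α} (hx : x ∈ (extChartAt (J1Model m α) p).target)
    (hΦ : Φ.toFun α ((extChartAt (J1Model m α) p).symm x) ∈ (extChartAt (𝓡 l) (1 : G)).source) :
    (thetaDPhi Φ α ((extChartAt (J1Model m α) p).symm x)).comp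
        (mfderiv 𝓘(ℝ, J1Vec m α) (J1Model m α) (extChartAt (J1Model m α) p).symm x) =
      (maurerCartanInChart l G (phiInChart Φ p x)).comp (fderiv ℝ (phiInChart Φ p) x) := by
  have hM : IsManifold (𝓡 l) ∞ G := inferInstance
  have ht : phiInChart Φ p x ∈ (extChartAt (𝓡 l) (1 : G)).target :=
    (extChartAt (𝓡 l) (1 : G)).map_source hΦ
  have h1 : MDifferentiableAt (J1Model m α) (𝓡 l) (Φ.toFun α)
      ((extChartAt (J1Model m α) p).symm x) := (Φ.smooth α).mdifferentiableAt (by simp)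
  have h2 := h1.hasMFDerivAt.comp x (mdifferentiableAt_extChartAt_J1_symm hx).hasMFDerivAt
  have h3 : MDifferentiableAt 𝓘(ℝ, EuclideanSpace ℝ (Fin l)) (𝓡 l)
      (extChartAt (𝓡 l) (1 : G)).symm (phiInChart Φ p x) := by
    have := mdifferentiableWithinAt_extChartAt_symm ht
    rwa [ModelWithCorners.range_eq_univ, mdifferentiableWithinAt_univ] at this
  have h4 := ((contDiffAt_phiInChart Φ hx hΦ).differentiableAt (by simp)).hasFDerivAt
  have h5 := h3.hasMFDerivAt.comp x h4.hasMFDerivAt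
  have h6 : ∀ᶠ x' in 𝓝 x, (Φ.toFun α ∘ (extChartAt (J1Model m α) p).symm) x' =
      ((extChartAt (𝓡 l) (1 : G)).symm ∘ phiInChart Φ p) x' := by
    have := h2.continuousAt.eventually
      ((isOpen_extChartAt_source (I := 𝓡 l) (1 : G)).mem_nhds hΦ)
    filter_upwards [this] with x' hx'
    exact ((extChartAt (𝓡 l) (1 : G)).left_inv hx').symm
  have h7 := hasMFDerivAt_unique h2 (h5.congr_of_eventuallyEq h6)
  have h8 : (extChartAt (𝓡 l) (1 : G)).symm (phiInChart Φ p x) =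
      Φ.toFun α ((extChartAt (J1Model m α) p).symm x) :=
    (extChartAt (𝓡 l) (1 : G)).left_inv hΦ
  rw [← maurerCartan_comp_mfderiv_symm ht, h8]
  refine ContinuousLinearMap.ext fun w => ?_
  exact congrArg (fun A : J1Vec m α →L[ℝ] EuclideanSpace ℝ (Fin l) =>
    maurerCartan l (Φ.toFun α ((extChartAt (J1Model m α) p).symm x)) (A w)) h7

end DiscreteLagrange

namespace DiscreteLagrange

variable {n : ℕ} {K : CellComplex n} {m : ℕ} {Y : K.Vertex → Type*}
  [∀ v, TopologicalSpace (Y v)] [∀ v, ChartedSpace (EuclideanSpace ℝ (Fin m)) (Y v)]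
  {l : ℕ} {G : Type*} [TopologicalSpace G] [ChartedSpace (EuclideanSpace ℝ (Fin l)) G]
  [Group G] {F : Finset K.Face}

theorem jetVec_extChartAt_self (q : SecMap Y l G F) (α : F) :
    jetVec m l G α (extChartAt (SecMapModel m l G F) q q) =
      extChartAt (J1Model m α.1) (jet q.1 α) (jet q.1 α) := rfl

theorem fderiv_phiInChart_self (Φ : Constraint m Y l G) {α : K.Face} {p : J1 Y α}
    (hp : Φ.toFun α p = 1) :
    fderiv ℝ (phiInChart Φ p) (extChartAt (J1Model m α) p p) =
      mfderiv (J1Model m α) (𝓡 l) (Φ.toFun α) p := by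
  have h1 : MDifferentiableAt (J1Model m α) (𝓡 l) (Φ.toFun α) p :=
    (Φ.smooth α).mdifferentiableAt (by simp)
  let A : J1Vec m α →L[ℝ] EuclideanSpace ℝ (Fin l) :=
    mfderiv (J1Model m α) (𝓡 l) (Φ.toFun α) p
  have h2 : HasFDerivWithinAt (writtenInExtChartAt (J1Model m α) (𝓡 l) p (Φ.toFun α)) A
      (range (J1Model m α)) (extChartAt (J1Model m α) p p) := h1.hasMFDerivAt.2
  rw [ModelWithCorners.range_eq_univ, hasFDerivWithinAt_univ, writtenInExtChartAt, hp] at h2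
  exact HasFDerivAt.fderiv (f := phiInChart Φ p) h2

/-! ### The decomposition of the action form by vertices -/

theorem mem_frontier_iff_notMem_interior {v : K.Vertex} (hv : v ∈ K.verts F) :
    v ∈ K.frontier (F : Set K.Face) ↔ v ∉ K.interior (F : Set K.Face) := by
  refine ⟨fun h => h.1, fun h => ⟨h, fun h' => ?_⟩⟩
  obtain ⟨α, hα, hvα⟩ := hv
  exact h' hvα hα

open Classical in
/-- Summing over the faces of `F` and their vertices amounts to summing over the interior and over
the frontier vertices, and the faces of `F` containing them. -/
theorem sum_faces_eq_sum_interior_add_sum_frontier (f : ∀ α : F, K.faceVerts α.1 → ℝ) :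
    ∑ α : F, ∑ v, f α v =
      ∑ v : {v : K.verts F // v.1 ∈ K.interior (F : Set K.Face)},
        ∑ α : {α : F // α.1 ∈ K.sphere v.1.1}, f α.1 ⟨v.1.1, α.2⟩ +
      ∑ v : {v : K.verts F // v.1 ∈ K.frontier (F : Set K.Face)},
        ∑ α : {α : F // K.Adherent v.1.1 α.1}, f α.1 ⟨v.1.1, α.2⟩ := by
  have h1 : ∑ α : F, ∑ v, f α v =
      ∑ v : K.verts F, ∑ α : {α : F // K.Adherent v.1 α.1}, f α.1 ⟨v.1, α.2⟩ := by
    rw [← Fintype.sum_sigma' (fun α v => f α v),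
      ← Fintype.sum_sigma' (fun (v : K.verts F) (α : {α : F // K.Adherent v.1 α.1}) =>
        f α.1 ⟨v.1, α.2⟩)]
    exact Fintype.sum_equiv
      { toFun := fun x => ⟨K.inclVert x.1 x.2, ⟨x.1, x.2.2⟩⟩
        invFun := fun x => ⟨x.2.1, ⟨x.1.1, x.2.2⟩⟩
        left_inv := fun _ => rfl
        right_inv := fun _ => rfl } _ _ fun _ => rfl
  rw [h1, ← Fintype.sum_subtype_add_sum_subtype
    (fun v : K.verts F => v.1 ∈ K.interior (F : Set K.Face))]
  refine congrArg₂ (· + ·) rfl ?_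
  exact Fintype.sum_equiv
    (Equiv.subtypeEquivRight fun v => (mem_frontier_iff_notMem_interior v.2).symm) _ _
    fun _ => rfl

theorem actionForm_apply (L : Lagrangian m Y) (Φ : Constraint m Y l G) (q : SecMap Y l G F)
    (X : SecMapVec m l G F) :
    actionForm L Φ F q X = ∑ α : F, ∑ v, cartanForm L Φ α v q X := by
  have hsum : ∀ (α : F) (A : J1Vec m α.1 →L[ℝ] ℝ) (x : J1Vec m α.1),
      A x = ∑ v, A (vertexVec m α.1 v x) := by
    intro α A x
    rw [← map_sum, ← _root_.sum_apply, sum_vertexVec]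
    rfl
  have hA : actionForm L Φ F q X = ∑ α : F, (dLagrangian L α.1 (jet q.1 α) +
      (q.2 α).comp (thetaDPhi Φ α.1 (jet q.1 α))) (jetVec m l G α X) :=
    _root_.sum_apply _ _ _
  rw [hA]
  exact Finset.sum_congr rfl fun α _ => hsum α _ _

open Classical in
theorem eulerLagrangeForm_apply (L : Lagrangian m Y) (Φ : Constraint m Y l G)
    (q : SecMap Y l G F) (X : SecMapVec m l G F) :
    eulerLagrangeForm L Φ F q X =
      ∑ v : {v : K.verts F // v.1 ∈ K.interior (F : Set K.Face)},
        ∑ α : {α : F // α.1 ∈ K.sphere v.1.1}, cartanForm L Φ α.1 ⟨v.1.1, α.2⟩ q X := by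
  refine (_root_.sum_apply _ _ _).trans (Finset.sum_congr rfl fun v _ => ?_)
  exact _root_.sum_apply _ _ _

open Classical in
/-- The Euler-Lagrange form vanishes at critical points. -/
theorem eulerLagrangeForm_eq_zero {L : Lagrangian m Y} {Φ : Constraint m Y l G}
    {q : SecMap Y l G F} (hq : IsCritical L Φ q) : eulerLagrangeForm L Φ F q = 0 := by
  refine ContinuousLinearMap.ext fun X => ?_
  let X' : SecMapVec m l G F :=
    (fun v => if v.1 ∈ K.frontier (F : Set K.Face) then 0 else (show SecMapVec m l G F from X).1 v,
      0)
  have h1 : actionForm L Φ F q X' = 0 := hq.2 X' fun v hv => if_pos hv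
  have hP : ∀ (α : F) (v : K.faceVerts α.1) (Z Z' : SecMapVec m l G F),
      Z.1 (K.inclVert α v) = Z'.1 (K.inclVert α v) →
        cartanForm L Φ α v q Z = cartanForm L Φ α v q Z' := by
    intro α v Z Z' h
    let A : J1Vec m α.1 →L[ℝ] ℝ :=
      dLagrangian L α.1 (jet q.1 α) + (q.2 α).comp (thetaDPhi Φ α.1 (jet q.1 α))
    have h' : vertexVec m α.1 v (jetVec m l G α Z) = vertexVec m α.1 v (jetVec m l G α Z') :=
      congrArg (ContinuousLinearMap.single ℝ
        (fun _ : K.faceVerts α.1 => EuclideanSpace ℝ (Fin m)) v) h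
    exact congrArg A h'
  rw [actionForm_apply, sum_faces_eq_sum_interior_add_sum_frontier] at h1
  have h2 : ∑ v : {v : K.verts F // v.1 ∈ K.frontier (F : Set K.Face)},
        ∑ α : {α : F // K.Adherent v.1.1 α.1}, cartanForm L Φ α.1 ⟨v.1.1, α.2⟩ q X' = 0 :=
    Finset.sum_eq_zero fun v _ => Finset.sum_eq_zero fun α _ =>
      (hP α.1 ⟨v.1.1, α.2⟩ X' 0 (if_pos v.2)).trans (map_zero _)
  rw [h2, add_zero] at h1
  refine (eulerLagrangeForm_apply L Φ q X).trans (Eq.trans ?_ h1)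
  refine Finset.sum_congr rfl fun v _ => Finset.sum_congr rfl fun α _ => ?_
  exact hP α.1 ⟨v.1.1, α.2⟩ X X' (if_neg fun h => h.1 v.2).symm

open Classical in
theorem inChart_eulerLagrangeForm (L : Lagrangian m Y) (Φ : Constraint m Y l G)
    (q : SecMap Y l G F) :
    OneForm.inChart (SecMapModel m l G F) (eulerLagrangeForm L Φ F) q = fun z =>
      ∑ v : {v : K.verts F // v.1 ∈ K.interior (F : Set K.Face)},
        ∑ α : {α : F // α.1 ∈ K.sphere v.1.1},
          OneForm.inChart (SecMapModel m l G F) (cartanForm L Φ α.1 ⟨v.1.1, α.2⟩) q z := by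
  refine funext fun z => ContinuousLinearMap.ext fun w => ?_
  refine (eulerLagrangeForm_apply L Φ _ _).trans ?_
  simp only [_root_.sum_apply]
  rfl

/-! ### Exterior derivatives of the Cartan forms -/

variable [∀ v, IsManifold (𝓡 m) ∞ (Y v)]

theorem fderiv_inChart_eulerLagrangeForm_eq_zero {L : Lagrangian m Y} {Φ : Constraint m Y l G}
    {q : SecMap Y l G F} (hq : IsCritical L Φ q) {X : SecMapVec m l G F}
    (hX : IsJacobi L Φ q X) :
    fderiv ℝ (OneForm.inChart (SecMapModel m l G F) (eulerLagrangeForm L Φ F) q)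
        (extChartAt (SecMapModel m l G F) q q) X = 0 := by
  obtain ⟨-, D, -, rfl, hD⟩ := hX
  have h := OneForm.fderivWithin_eq_zero_of_lieDeriv_eq_zero (eulerLagrangeForm_eq_zero hq) hD
  rwa [ModelWithCorners.range_eq_univ, fderivWithin_univ] at h

variable [LieGroup (𝓡 l) ∞ G]

theorem inChart_cartanForm_eventuallyEq (L : Lagrangian m Y) (Φ : Constraint m Y l G)
    (q : SecMap Y l G F) (α : F) (hα : Φ.toFun α.1 (jet q.1 α) = 1) (v : K.faceVerts α.1) :
    OneForm.inChart (SecMapModel m l G F) (cartanForm L Φ α v) q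
      =ᶠ[𝓝 (extChartAt (SecMapModel m l G F) q q)]
      fun z => (actionInChart L Φ q α z).comp ((vertexVec m α.1 v).comp (jetVec m l G α)) := by
  have hc : ContinuousAt (jetVec m l G α) (extChartAt (SecMapModel m l G F) q q) :=
    (jetVec m l G α).continuous.continuousAt
  have ht : extChartAt (J1Model m α.1) (jet q.1 α) (jet q.1 α) ∈
      (extChartAt (J1Model m α.1) (jet q.1 α)).target := mem_extChartAt_target _
  have hΦc : ContinuousAt (fun x => Φ.toFun α.1 ((extChartAt (J1Model m α.1) (jet q.1 α)).symm x))
      (extChartAt (J1Model m α.1) (jet q.1 α) (jet q.1 α)) :=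
    ((Φ.smooth α.1).continuous.continuousAt).comp (contMDiffAt_extChartAt_J1_symm ht).continuousAt
  have hΦs : ∀ᶠ x in 𝓝 (extChartAt (J1Model m α.1) (jet q.1 α) (jet q.1 α)),
      Φ.toFun α.1 ((extChartAt (J1Model m α.1) (jet q.1 α)).symm x) ∈
        (extChartAt (𝓡 l) (1 : G)).source := by
    refine hΦc.eventually ((isOpen_extChartAt_source (I := 𝓡 l) (1 : G)).mem_nhds ?_)
    beta_reduce
    rw [extChartAt_to_inv, hα]
    exact mem_extChartAt_source _
  filter_upwards [extChartAt_target_mem_nhds (I := SecMapModel m l G F) q,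
    hc.eventually ((isOpen_extChartAt_target (I := J1Model m α.1) (jet q.1 α)).mem_nhds ht),
    hc.eventually hΦs] with z hz hz' hΦ
  unfold OneForm.inChart
  rw [ModelWithCorners.range_eq_univ, mfderivWithin_univ]
  refine ContinuousLinearMap.ext fun w => ?_
  let p : J1 Y α.1 := (extChartAt (J1Model m α.1) (jet q.1 α)).symm (jetVec m l G α z)
  let A : J1Vec m α.1 →L[ℝ] J1Vec m α.1 :=
    mfderiv 𝓘(ℝ, J1Vec m α.1) (J1Model m α.1) (extChartAt (J1Model m α.1) (jet q.1 α)).symm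
        (jetVec m l G α z)
  let P : J1Vec m α.1 →L[ℝ] J1Vec m α.1 := vertexProj (m := m) α.1 v p
  let dL : J1Vec m α.1 →L[ℝ] ℝ := dLagrangian L α.1 p
  let θ : J1Vec m α.1 →L[ℝ] LieAlg l G := thetaDPhi Φ α.1 p
  let x : J1Vec m α.1 := jetTangent ((extChartAt (SecMapModel m l G F) q).symm z).1 α
    (tangentFst ((extChartAt (SecMapModel m l G F) q).symm z)
        (mfderiv 𝓘(ℝ, SecMapVec m l G F) (SecMapModel m l G F)
          (extChartAt (SecMapModel m l G F) q).symm z w))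
  have e1 : x = A (jetVec m l G α w) :=
    congrArg (fun B : SecMapVec m l G F →L[ℝ] J1Vec m α.1 => B w)
      (jetTangent_comp_mfderiv_symm α hz hz')
  have e2 : ∀ a, P (A a) = A (vertexVec m α.1 v a) := fun a =>
    congrArg (fun B : J1Vec m α.1 →L[ℝ] J1Vec m α.1 => B a) (vertexProj_comp_mfderiv_symm v hz')
  have e3 : ∀ a, dL (A a) = fderiv ℝ (lagInChart L (jet q.1 α)) (jetVec m l G α z) a := fun a =>
    congrArg (fun B : J1Vec m α.1 →L[ℝ] ℝ => B a) (dLagrangian_comp_mfderiv_symm L hz')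
  have e4 : ∀ a, θ (A a) = maurerCartanInChart l G
      (phiInChart Φ (jet q.1 α) (jetVec m l G α z))
        (fderiv ℝ (phiInChart Φ (jet q.1 α)) (jetVec m l G α z) a) := fun a =>
    congrArg (fun B : J1Vec m α.1 →L[ℝ] LieAlg l G => B a) (thetaDPhi_comp_mfderiv_symm Φ hz' hΦ)
  have e5 : dL (P x) + z.2 α (θ (P x)) =
      actionInChart L Φ q α z (vertexVec m α.1 v (jetVec m l G α w)) := by
    rw [e1, e2, e3, e4]
    rfl
  exact e5

theorem contDiffAt_phiInChart_self (Φ : Constraint m Y l G) {α : K.Face} {p : J1 Y α}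
    (hp : Φ.toFun α p = 1) :
    ContDiffAt ℝ ∞ (phiInChart Φ p) (extChartAt (J1Model m α) p p) := by
  refine contDiffAt_phiInChart Φ (mem_extChartAt_target _) ?_
  rw [extChartAt_to_inv, hp]
  exact mem_extChartAt_source _

theorem differentiableAt_comp_maurerCartanInChart (Φ : Constraint m Y l G)
    (q : SecMap Y l G F) (α : F) (hα : Φ.toFun α.1 (jet q.1 α) = 1) :
    DifferentiableAt ℝ (fun z : SecMapVec m l G F => (z.2 α).comp
      (maurerCartanInChart l G (phiInChart Φ (jet q.1 α) (jetVec m l G α z))))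
      (extChartAt (SecMapModel m l G F) q q) := by
  have h1 : phiInChart Φ (jet q.1 α)
      (jetVec m l G α (extChartAt (SecMapModel m l G F) q q)) ∈
        (extChartAt (𝓡 l) (1 : G)).target := by
    rw [jetVec_extChartAt_self, phiInChart, extChartAt_to_inv, hα]
    exact mem_extChartAt_target _
  have h2 : DifferentiableAt ℝ (fun z : SecMapVec m l G F => phiInChart Φ (jet q.1 α)
      (jetVec m l G α z)) (extChartAt (SecMapModel m l G F) q q) :=
    ((contDiffAt_phiInChart_self Φ hα).differentiableAt (by simp)).comp (g := phiInChart Φ (jet q.1 α))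
      (extChartAt (SecMapModel m l G F) q q) (jetVec m l G α).differentiableAt
  have h3 : DifferentiableAt ℝ (fun z : SecMapVec m l G F => maurerCartanInChart l G
      (phiInChart Φ (jet q.1 α) (jetVec m l G α z))) (extChartAt (SecMapModel m l G F) q q) :=
    ((contDiffAt_maurerCartanInChart h1).differentiableAt (by simp)).comp
      (g := maurerCartanInChart l G)
      (extChartAt (SecMapModel m l G F) q q) h2
  have h4 : DifferentiableAt ℝ (fun z : SecMapVec m l G F => z.2 α)
      (extChartAt (SecMapModel m l G F) q q) :=
    ((ContinuousLinearMap.proj (R := ℝ) (φ := fun _ : F => LieCoalg l G) α).comp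
      (ContinuousLinearMap.snd ℝ (K.verts F → EuclideanSpace ℝ (Fin m))
        (F → LieCoalg l G))).differentiableAt
  exact h4.clm_comp h3

theorem differentiableAt_actionInChart (L : Lagrangian m Y) (Φ : Constraint m Y l G)
    (q : SecMap Y l G F) (α : F) (hα : Φ.toFun α.1 (jet q.1 α) = 1) :
    DifferentiableAt ℝ (actionInChart L Φ q α) (extChartAt (SecMapModel m l G F) q q) :=
  differentiableAt_fderiv_add_comp_fderiv
    (contDiffAt_lagInChart L (mem_extChartAt_target _))
    (contDiffAt_phiInChart_self Φ hα) (differentiableAt_comp_maurerCartanInChart Φ q α hα)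

/-- The form `dℒ_α + λ_α ∘ (θ ∘ dΦ_α)` is closed on admissible variations. -/
theorem fderiv_actionInChart_sub_swap_eq_zero (L : Lagrangian m Y) (Φ : Constraint m Y l G)
    (q : SecMap Y l G F) (α : F) (hα : Φ.toFun α.1 (jet q.1 α) = 1) {u w : SecMapVec m l G F}
    (hu : mfderiv (J1Model m α.1) (𝓡 l) (Φ.toFun α.1) (jet q.1 α) (jetVec m l G α u) = 0)
    (hw : mfderiv (J1Model m α.1) (𝓡 l) (Φ.toFun α.1) (jet q.1 α) (jetVec m l G α w) = 0) :
    fderiv ℝ (actionInChart L Φ q α) (extChartAt (SecMapModel m l G F) q q) u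
        (jetVec m l G α w) -
      fderiv ℝ (actionInChart L Φ q α) (extChartAt (SecMapModel m l G F) q q) w
        (jetVec m l G α u) = 0 := by
  have hd := fderiv_phiInChart_self Φ hα
  exact fderiv_fderiv_add_comp_fderiv_sub_swap_eq_zero
    (contDiffAt_lagInChart L (mem_extChartAt_target _))
    (contDiffAt_phiInChart_self Φ hα) (differentiableAt_comp_maurerCartanInChart Φ q α hα)
    ((congrArg (fun A : J1Vec m α.1 →L[ℝ] EuclideanSpace ℝ (Fin l) => A (jetVec m l G α u))
      hd).trans hu)
    ((congrArg (fun A : J1Vec m α.1 →L[ℝ] EuclideanSpace ℝ (Fin l) => A (jetVec m l G α w))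
      hd).trans hw)

theorem hasFDerivAt_inChart_cartanForm (L : Lagrangian m Y) (Φ : Constraint m Y l G)
    (q : SecMap Y l G F) (α : F) (hα : Φ.toFun α.1 (jet q.1 α) = 1) (v : K.faceVerts α.1) :
    HasFDerivAt (OneForm.inChart (SecMapModel m l G F) (cartanForm L Φ α v) q)
      ((ContinuousLinearMap.precomp ℝ ((vertexVec m α.1 v).comp (jetVec m l G α))).comp
          (fderiv ℝ (actionInChart L Φ q α) (extChartAt (SecMapModel m l G F) q q)))
      (extChartAt (SecMapModel m l G F) q q) := by
  refine HasFDerivAt.congr_of_eventuallyEq ?_ (inChart_cartanForm_eventuallyEq L Φ q α hα v)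
  exact hasFDerivAt_clm_comp_const (differentiableAt_actionInChart L Φ q α hα).hasFDerivAt _

theorem extDeriv_cartanForm (L : Lagrangian m Y) (Φ : Constraint m Y l G)
    (q : SecMap Y l G F) (α : F) (hα : Φ.toFun α.1 (jet q.1 α) = 1) (v : K.faceVerts α.1)
    (u w : SecMapVec m l G F) :
    OneForm.extDeriv (SecMapModel m l G F) (cartanForm L Φ α v) q u w =
      fderiv ℝ (actionInChart L Φ q α) (extChartAt (SecMapModel m l G F) q q) u
          (vertexVec m α.1 v (jetVec m l G α w)) -
        fderiv ℝ (actionInChart L Φ q α) (extChartAt (SecMapModel m l G F) q q) w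
          (vertexVec m α.1 v (jetVec m l G α u)) := by
  have h := hasFDerivAt_inChart_cartanForm L Φ q α hα v
  rw [OneForm.extDeriv_eq_fderivWithin h.differentiableAt.differentiableWithinAt,
    ModelWithCorners.range_eq_univ, fderivWithin_univ, h.fderiv]
  rfl

theorem sum_extDeriv_cartanForm_eq_zero (L : Lagrangian m Y) (Φ : Constraint m Y l G)
    (q : SecMap Y l G F) (α : F) (hα : Φ.toFun α.1 (jet q.1 α) = 1) {u w : SecMapVec m l G F}
    (hu : mfderiv (J1Model m α.1) (𝓡 l) (Φ.toFun α.1) (jet q.1 α) (jetVec m l G α u) = 0)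
    (hw : mfderiv (J1Model m α.1) (𝓡 l) (Φ.toFun α.1) (jet q.1 α) (jetVec m l G α w) = 0) :
    ∑ v, OneForm.extDeriv (SecMapModel m l G F) (cartanForm L Φ α v) q u w = 0 := by
  simp only [extDeriv_cartanForm L Φ q α hα, Finset.sum_sub_distrib, ← map_sum,
    ← _root_.sum_apply, sum_vertexVec]
  exact fderiv_actionInChart_sub_swap_eq_zero L Φ q α hα hu hw

open Classical in
theorem fderiv_inChart_eulerLagrangeForm (L : Lagrangian m Y) (Φ : Constraint m Y l G)
    (q : SecMap Y l G F) (hq : IsAdmissible Φ q.1) (u w : SecMapVec m l G F) :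
    fderiv ℝ (OneForm.inChart (SecMapModel m l G F) (eulerLagrangeForm L Φ F) q)
        (extChartAt (SecMapModel m l G F) q q) u w =
      ∑ v : {v : K.verts F // v.1 ∈ K.interior (F : Set K.Face)},
        ∑ α : {α : F // α.1 ∈ K.sphere v.1.1},
          fderiv ℝ (actionInChart L Φ q α.1) (extChartAt (SecMapModel m l G F) q q) u
            (vertexVec m α.1.1 ⟨v.1.1, α.2⟩ (jetVec m l G α.1 w)) := by
  have h := HasFDerivAt.fun_sum (u := Finset.univ)
    fun (v : {v : K.verts F // v.1 ∈ K.interior (F : Set K.Face)}) _ =>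
    HasFDerivAt.fun_sum (u := Finset.univ) fun (α : {α : F // α.1 ∈ K.sphere v.1.1}) _ =>
      hasFDerivAt_inChart_cartanForm L Φ q α.1 (hq α.1) ⟨v.1.1, α.2⟩
  rw [inChart_eulerLagrangeForm, h.fderiv]
  simp only [_root_.sum_apply]
  rfl

end DiscreteLagrange

open Classical DiscreteLagrange in
theorem mainTheorem6 {n : ℕ} (K : CellComplex n) (m : ℕ) (Y : K.Vertex → Type*)
    [∀ v, TopologicalSpace (Y v)] [∀ v, ChartedSpace (EuclideanSpace ℝ (Fin m)) (Y v)]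
    [∀ v, IsManifold (𝓡 m) ∞ (Y v)]
    (l : ℕ) (G : Type*) [TopologicalSpace G] [ChartedSpace (EuclideanSpace ℝ (Fin l)) G]
    [Group G] [LieGroup (𝓡 l) ∞ G]
    (L : Lagrangian m Y) (Φ : Constraint m Y l G)
    (F : Finset K.Face) (q : SecMap Y l G F) (hq : IsCritical L Φ q)
    (X₁ X₂ : TangentSpace (SecMapModel m l G F) q)
    (hX₁ : IsJacobi L Φ q X₁) (hX₂ : IsJacobi L Φ q X₂) :
    ∑ v : {v : K.verts F // v.1 ∈ K.frontier (F : Set K.Face)},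
      ∑ α : {α : F // K.Adherent v.1.1 α.1},
        OneForm.extDeriv (SecMapModel m l G F) (cartanForm L Φ α.1 ⟨v.1.1, α.2⟩) q X₁ X₂ = 0 := by
  have hall : ∑ α : F, ∑ v,
      OneForm.extDeriv (SecMapModel m l G F) (cartanForm L Φ α v) q X₁ X₂ = 0 :=
    Finset.sum_eq_zero fun α _ =>
      sum_extDeriv_cartanForm_eq_zero L Φ q α (hq.1 α) (hX₁.1 α) (hX₂.1 α)
  have hint : ∑ v : {v : K.verts F // v.1 ∈ K.interior (F : Set K.Face)},
      ∑ α : {α : F // α.1 ∈ K.sphere v.1.1},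
        OneForm.extDeriv (SecMapModel m l G F) (cartanForm L Φ α.1 ⟨v.1.1, α.2⟩) q X₁ X₂ = 0 := by
    have e := fderiv_inChart_eulerLagrangeForm L Φ q hq.1
    have h₁ := (e X₁ X₂).symm.trans
      (congrArg (fun A : SecMapVec m l G F →L[ℝ] ℝ => A X₂)
        (fderiv_inChart_eulerLagrangeForm_eq_zero hq hX₁))
    have h₂ := (e X₂ X₁).symm.trans
      (congrArg (fun A : SecMapVec m l G F →L[ℝ] ℝ => A X₁)
        (fderiv_inChart_eulerLagrangeForm_eq_zero hq hX₂))
    have h₃ := congrArg₂ (fun a b : ℝ => a - b) h₁ h₂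
    simp only [← Finset.sum_sub_distrib] at h₃
    refine Eq.trans (Finset.sum_congr rfl fun v _ => Finset.sum_congr rfl fun α _ =>
      extDeriv_cartanForm L Φ q α.1 (hq.1 α.1) _ X₁ X₂) (h₃.trans (sub_self 0))
  rw [sum_faces_eq_sum_interior_add_sum_frontier, hint, zero_add] at hall
  exact hall
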